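/- Rings are associative and not necessarily unital. A ring $S$ is (von Neumann) regular if for every $x\in S$ there is $y\in S$ with $x=xyx$; it is $\sigma$-unital if there is a sequence $(e_n)_{n\in\mathbb N}$ in $S$ such that for each $x\in S$ one has $e_nx=xe_n=x$ for all sufficiently large $n$. The multiplier ring $\mathcal M(S)$ is the unital ring of double centralizers of $S$, i.e. of pairs $(\lambda,\rho)$ of additive maps $S\to S$ with $\lambda(xy)=\lambda(x)y$, $\rho(xy)=x\rho(y)$ and $x\lambda(y)=\rho(x)y$ for all $x,y\in S$, with componentwise addition and product $(\lambda_1,\rho_1)(\lambda_2,\rho_2)=(\lambda_1\circ\lambda_2,\rho_2\circ\rho_1)$. A unital ring $A$ is an exchange ring if for each $x\in A$ there is an idempotent $e\in xA$ such that $1-e=(1-x)(1-y)$ for some $y\in A$. **Corollary.** Let $(R_n)_{n\ge 0}$ be a sequence of $\sigma$-unital von Neumann regular rings with surjective ring homomorphisms $\pi_n\colon R_{n+1}\to R_n$, and let $R=\varprojlim R_n=\{(x_n)\in\prod_n R_n : \pi_n(x_{n+1})=x_n \text{ for all } n\}$ be their inverse limit. Then $\mathcal M(R)$ is an exchange ring.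 -/

import Mathlib

universe u

/-- A (not necessarily unital) ring is von Neumann regular if every `x` has a partial inverse:
`x = x y x` for some `y`. -/
def IsVonNeumannRegularRing (R : Type u) [NonUnitalRing R] : Prop :=
  ∀ x : R, ∃ y : R, x = x * y * x

/-- A (not necessarily unital) ring is `σ`-unital if it has a countable approximate unit:
a sequence `(eₙ)` such that, for each `x`, eventually `eₙ x = x eₙ = x`. -/
def IsSigmaUnital (R : Type u) [NonUnitalRing R] : Prop :=
  ∃ e : ℕ → R, ∀ x : R, ∀ᶠ n in Filter.atTop, e n * x = x ∧ x * e n = x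

/-- A unital ring is an exchange ring if for each `x` there is an idempotent `e ∈ x R` with
`1 - e = (1 - x)(1 - y)` for some `y`. -/
def IsExchangeRing (R : Type u) [Ring R] : Prop :=
  ∀ x : R, ∃ e : R, IsIdempotentElem e ∧ (∃ r : R, e = x * r) ∧
    ∃ y : R, 1 - e = (1 - x) * (1 - y)

/-- The inverse limit of a sequence of rings with connecting morphisms `π n : R (n+1) → R n`:
the ring of all strings `(xₙ)` in `∏ Rₙ` with `π n (x (n+1)) = x n`. -/
def inverseLimit (R : ℕ → Type u) [∀ n, NonUnitalRing (R n)] (π : ∀ n, R (n + 1) →ₙ+* R n) :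
    NonUnitalSubring (∀ n, R n) where
  carrier := {x | ∀ n, π n (x (n + 1)) = x n}
  zero_mem' n := map_zero (π n)
  add_mem' ha hb n := by
    simp only [Pi.add_apply, map_add]
    rw [ha n, hb n]
  neg_mem' ha n := by
    simp only [Pi.neg_apply, map_neg]
    rw [ha n]
  mul_mem' ha hb n := by
    simp only [Pi.mul_apply, map_mul]
    rw [ha n, hb n]

/-- The multiplier ring of `R`: the ring of double centralizers `(l, r)`, where
`l (x y) = l x * y`, `r (x y) = x * r y` and `x * l y = r x * y`, with componentwise addition and
product `(l₁, r₁)(l₂, r₂) = (l₁ ∘ l₂, r₂ ∘ r₁)`; the reversed order in the second component is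
encoded by the opposite ring. -/
def multiplierRing (R : Type u) [NonUnitalRing R] :
    Subring (AddMonoid.End R × (AddMonoid.End R)ᵐᵒᵖ) where
  carrier := {m | (∀ x y, m.1 (x * y) = m.1 x * y) ∧ (∀ x y, m.2.unop (x * y) = x * m.2.unop y) ∧
    ∀ x y, x * m.1 y = m.2.unop x * y}
  one_mem' := ⟨fun _ _ => rfl, fun _ _ => rfl, fun _ _ => rfl⟩
  zero_mem' := by
    refine ⟨fun x y => ?_, fun x y => ?_, fun x y => ?_⟩ <;> simp
  add_mem' := by
    rintro a b ⟨ha, ha', ha''⟩ ⟨hb, hb', hb''⟩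
    refine ⟨fun x y => ?_, fun x y => ?_, fun x y => ?_⟩
    · change a.1 (x * y) + b.1 (x * y) = (a.1 x + b.1 x) * y
      rw [ha, hb, add_mul]
    · change a.2.unop (x * y) + b.2.unop (x * y) = x * (a.2.unop y + b.2.unop y)
      rw [ha', hb', mul_add]
    · change x * (a.1 y + b.1 y) = (a.2.unop x + b.2.unop x) * y
      rw [mul_add, ha'', hb'', add_mul]
  neg_mem' := by
    rintro a ⟨ha, ha', ha''⟩
    refine ⟨fun x y => ?_, fun x y => ?_, fun x y => ?_⟩
    · change -a.1 (x * y) = -a.1 x * y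
      rw [ha, neg_mul]
    · change -a.2.unop (x * y) = x * -a.2.unop y
      rw [ha', mul_neg]
    · change x * -a.1 y = -a.2.unop x * y
      rw [mul_neg, ha'', neg_mul]
  mul_mem' := by
    rintro a b ⟨ha, ha', ha''⟩ ⟨hb, hb', hb''⟩
    refine ⟨fun x y => ?_, fun x y => ?_, fun x y => ?_⟩
    · simp [ha, hb]
    · simp [ha', hb']
    · simp [ha'', hb'']

/-- In a non-degenerate ring the additivity and module properties of a double centralizer are
automatic: any pair of maps with `x * l y = r x * y` is one. -/
theorem exists_mem_multiplierRing_of_coherent {R : Type u} [NonUnitalRing R]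
    (hl : ∀ x : R, (∀ y, y * x = 0) → x = 0) (hr : ∀ x : R, (∀ y, x * y = 0) → x = 0)
    (l r : R → R) (h : ∀ x y, x * l y = r x * y) :
    ∃ m ∈ multiplierRing R, (∀ x, m.1 x = l x) ∧ ∀ x, m.2.unop x = r x := by
  have hl' : ∀ a b : R, (∀ y, y * a = y * b) → a = b := fun a b hab =>
    sub_eq_zero.1 (hl _ fun y => by rw [mul_sub, hab, sub_self])
  have hr' : ∀ a b : R, (∀ y, a * y = b * y) → a = b := fun a b hab =>
    sub_eq_zero.1 (hr _ fun y => by rw [sub_mul, hab, sub_self])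
  refine ⟨(AddMonoidHom.mk' l fun a b => hl' _ _ fun y => ?_,
    MulOpposite.op (AddMonoidHom.mk' r fun a b => hr' _ _ fun y => ?_)),
    ⟨fun x y => hl' _ _ fun z => ?_, fun x y => hr' _ _ fun z => ?_, h⟩,
    fun _ => rfl, fun _ => rfl⟩
  · rw [mul_add, h, h, h, mul_add]
  · rw [add_mul, ← h, ← h, ← h, add_mul]
  · change z * l (x * y) = z * (l x * y)
    rw [h, ← mul_assoc, ← mul_assoc, h]
  · change r (x * y) * z = x * r y * z
    rw [← h, mul_assoc, mul_assoc, h]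

/-!
The multiplier ring of the limit is the limit of the multiplier rings of the `R n`, so three facts
give the theorem.

The exchange property passes to surjective inverse limits of unital rings
(`IsExchangeRing.of_limit`), because the witnesses of the exchange property at `x`, suitably
normalised, lift along surjections of exchange rings (`IsExchangePair.exists_lift`).

A surjection `S → T` of `σ`-unital regular rings induces a surjection of multiplier rings
(`multiplierRing.map_surjective`): a multiplier of `T` is a strict sum of elements of corners of
`T`, and these can be lifted so that the lifts are strictly summable again.

The multiplier ring `A` of a `σ`-unital regular ring `S` is an exchange ring
(`IsStrictExhaustion.isExchangeRing`). It suffices to change `x` by multiples `(x - x ^ 2) w` until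
it becomes an idempotent. Such changes compose, and one suffices when `x - x ^ 2` is von Neumann
regular in `A`. The ring `A` itself is not regular, but the block diagonal elements with respect to
an approximate unit of idempotents form a regular subring, because the blocks lie in `S`. Along a
subsequence of the approximate unit, `x` is block tridiagonal. Around a sparse sequence of cuts, let
`M` be the sum of the neighbouring blocks. The right ideal `M A + x M A` is a direct sum of pieces
living in disjoint blocks, and is therefore generated by a block diagonal idempotent `π`. On each
piece the exchange property holds by regularity of `S`, which yields a change of `x` after which `x`
leaves the range of `π` invariant and is idempotent on it. As the range of `π` contains the
surroundings of the cuts, the compression of `x` to the complement is block diagonal, hence can be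
corrected to an idempotent. What remains is a triangular `x` with `(x - x ^ 2) ^ 2 = 0`, and then
`3 x ^ 2 - 2 x ^ 3` is an idempotent. The algebra is in `exists_correction_of_regular_subrings`, and
the choice of the cuts in `IsStrictExhaustion.exists_correction_of_tridiagonal`.
-/

/-! ### Exchange pairs and inverse limits -/

/-- `(r, s)` witnesses the exchange property at `x`: the element `x * r` is an idempotent, its
complement is `(1 - x) * s`, and `r`, `s` are normalised by `r * (x * r) = r` and
`s * ((1 - x) * s) = s`. The normalisation is what makes such pairs lift through surjections. -/
structure IsExchangePair {A : Type*} [Ring A] (x r s : A) : Prop where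
  add_eq_one : x * r + (1 - x) * s = 1
  left : r * (x * r) = r
  right : s * ((1 - x) * s) = s

namespace IsExchangePair

variable {A : Type*} [Ring A] {x r s : A}

theorem compl (h : IsExchangePair x r s) : (1 - x) * s = 1 - x * r :=
  eq_sub_of_add_eq' h.add_eq_one

theorem isIdempotentElem (h : IsExchangePair x r s) : IsIdempotentElem (x * r) := by
  rw [IsIdempotentElem, mul_assoc, h.left]

/-- Multiplying by the idempotent and its complement normalises a witness of the exchange
property. -/
theorem of_idempotent {e r s : A} (he : IsIdempotentElem e) (hr : x * r = e)
    (hs : (1 - x) * s = 1 - e) : IsExchangePair x (r * e) (s * (1 - e)) := by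
  have h1 : x * (r * e) = e := by rw [← mul_assoc, hr, he.eq]
  have h2 : (1 - x) * (s * (1 - e)) = 1 - e := by rw [← mul_assoc, hs, he.one_sub.eq]
  exact ⟨by rw [h1, h2]; abel, by rw [h1, mul_assoc, he.eq], by rw [h2, mul_assoc, he.one_sub.eq]⟩

end IsExchangePair

theorem isExchangeRing_iff_exists_pair {A : Type u} [Ring A] :
    IsExchangeRing A ↔ ∀ x : A, ∃ r s, IsExchangePair x r s := by
  constructor
  · intro h x
    obtain ⟨e, he, ⟨r, hr⟩, y, hy⟩ := h x
    exact ⟨_, _, .of_idempotent he hr.symm hy.symm⟩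
  · intro h x
    obtain ⟨r, s, hrs⟩ := h x
    exact ⟨x * r, hrs.isIdempotentElem, ⟨r, rfl⟩, 1 - s, by rw [sub_sub_cancel, hrs.compl]⟩

/-- Exchange pairs lift through surjections out of an exchange ring. Lifts of the two components
can be corrected so that `x * r + (1 - x) * s = 1`; then the exchange property is applied to
`a = x * r`, which is an idempotent modulo the kernel. -/
theorem IsExchangePair.exists_lift {A B : Type u} [Ring A] [Ring B] (hA : IsExchangeRing A)
    (f : A →+* B) (hf : Function.Surjective f) {x : A} {r₀ s₀ : B}
    (h : IsExchangePair (f x) r₀ s₀) :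
    ∃ r s, IsExchangePair x r s ∧ f r = r₀ ∧ f s = s₀ := by
  obtain ⟨r₁, hr₁⟩ := hf r₀
  obtain ⟨s₁, hs₁⟩ := hf s₀
  obtain ⟨r, s, hrs, hr, hs⟩ : ∃ r s, x * r + (1 - x) * s = 1 ∧ f r = r₀ ∧ f s = s₀ := by
    refine ⟨r₁ + (1 - (x * r₁ + (1 - x) * s₁)), s₁ + (1 - (x * r₁ + (1 - x) * s₁)), ?_, ?_, ?_⟩
    · noncomm_ring
    · simp [hr₁, hs₁, h.add_eq_one]
    · simp [hr₁, hs₁, h.add_eq_one]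
  have hs' : (1 - x) * s = 1 - x * r := eq_sub_of_add_eq' hrs
  obtain ⟨r', s', h'⟩ := isExchangeRing_iff_exists_pair.1 hA (x * r)
  obtain ⟨a, ha⟩ : ∃ a, a = x * r := ⟨_, rfl⟩
  rw [← ha] at h' hs'
  have hE := h'.isIdempotentElem
  obtain ⟨E, hEa⟩ : ∃ E, E = a * r' := ⟨_, rfl⟩
  obtain ⟨δ, hδ⟩ : ∃ δ, δ = r' - s' := ⟨_, rfl⟩
  have hE1 : E = a + a * (1 - a) * δ := by
    have h1 : a * ((1 - a) * s') = a * (1 - E) := by rw [h'.compl, hEa]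
    calc E = a + ((1 - a) * E - a * (1 - E)) := by noncomm_ring
      _ = a + a * (1 - a) * δ := by
        rw [← h1, hEa, hδ]; noncomm_ring
  have hfa : f a = f x * r₀ := by rw [ha, map_mul, hr]
  have hfr : f r * (1 - f a) = 0 := by rw [hfa, hr, mul_sub, mul_one, h.left, sub_self]
  have hfs : f s * f a = 0 := by
    have := h.right
    rw [h.compl, ← hfa, mul_sub, mul_one, sub_eq_self] at this
    rw [hs, this]
  have hfE : f E = f a := by
    have : f a * (1 - f a) = 0 := by rw [ha, map_mul, mul_assoc, ← map_mul, ← ha, hfr, mul_zero]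
    rw [hE1]
    simp [this]
  rw [← hEa] at hE
  have h1 : x * (r + r * (1 - a) * δ) = E := by
    rw [hE1, mul_add, ← ha, ← mul_assoc, ← mul_assoc, ← ha]
  have h2 : (1 - x) * (s - s * a * δ) = 1 - E := by
    rw [mul_sub, ← mul_assoc, ← mul_assoc, hs', hE1]; noncomm_ring
  refine ⟨_, _, .of_idempotent hE h1 h2, ?_, ?_⟩
  · rw [map_mul, hfE, map_add, map_mul, map_mul, map_sub, map_one, hfr, zero_mul, add_zero, hr,
      hfa, h.left]
  · rw [map_mul, map_sub, map_sub, map_one, hfE, map_mul, map_mul, hfs, zero_mul, sub_zero, hs,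
      hfa, ← h.compl, h.right]

/-- The exchange property passes to the limit of a sequence of exchange rings with surjective
connecting maps. The limit is described by its cone `φ`: a compatible sequence comes from exactly
one element of `A`. -/
theorem IsExchangeRing.of_limit {A : Type u} [Ring A] {B : ℕ → Type u} [∀ n, Ring (B n)]
    (φ : ∀ n, A →+* B n) (f : ∀ n, B (n + 1) →+* B n) (hf : ∀ n, Function.Surjective (f n))
    (hφ : ∀ n a, f n (φ (n + 1) a) = φ n a)
    (hinj : ∀ a b, (∀ n, φ n a = φ n b) → a = b)
    (hex : ∀ b : ∀ n, B n, (∀ n, f n (b (n + 1)) = b n) → ∃ a, ∀ n, φ n a = b n)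
    (hB : ∀ n, IsExchangeRing (B n)) : IsExchangeRing A := by
  refine isExchangeRing_iff_exists_pair.2 fun x => ?_
  have h0 : ∃ p : B 0 × B 0, IsExchangePair (φ 0 x) p.1 p.2 := by
    obtain ⟨r, s, h⟩ := isExchangeRing_iff_exists_pair.1 (hB 0) (φ 0 x)
    exact ⟨(r, s), h⟩
  have hstep : ∀ n (p : {p : B n × B n // IsExchangePair (φ n x) p.1 p.2}),
      ∃ p' : {p : B (n + 1) × B (n + 1) // IsExchangePair (φ (n + 1) x) p.1 p.2},
        f n p'.1.1 = p.1.1 ∧ f n p'.1.2 = p.1.2 := by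
    rintro n ⟨⟨r, s⟩, h⟩
    rw [← hφ] at h
    obtain ⟨r', s', h', hr, hs⟩ := h.exists_lift (hB (n + 1)) (f n) (hf n)
    exact ⟨⟨(r', s'), h'⟩, hr, hs⟩
  choose next hnext using hstep
  let p : ∀ n, {p : B n × B n // IsExchangePair (φ n x) p.1 p.2} := fun n =>
    Nat.rec ⟨h0.choose, h0.choose_spec⟩ (fun n q => next n q) n
  obtain ⟨r, hr⟩ := hex (fun n => (p n).1.1) fun n => (hnext n (p n)).1
  obtain ⟨s, hs⟩ := hex (fun n => (p n).1.2) fun n => (hnext n (p n)).2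
  refine ⟨r, s, hinj _ _ fun n => ?_, hinj _ _ fun n => ?_, hinj _ _ fun n => ?_⟩
  · simpa [hr, hs] using (p n).2.add_eq_one
  · simpa [hr, hs] using (p n).2.left
  · simpa [hr, hs] using (p n).2.right

/-! ### Correcting an element to an idempotent modulo `x - x ^ 2` -/

section Correction

variable {A : Type*} [Ring A]

/-- An idempotent in `x + (x - x ^ 2) A` witnesses the exchange property at `x`. -/
theorem exists_isExchangePair_of_correction {x w : A}
    (h : IsIdempotentElem (x + (x - x * x) * w)) : ∃ r s, IsExchangePair x r s :=
  ⟨_, _, .of_idempotent h (r := 1 + (1 - x) * w) (s := 1 - x * w) (by noncomm_ring)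
    (by noncomm_ring)⟩

/-- Corrections by `x - x ^ 2` can be composed, because `x - x ^ 2` divides `x' - x' ^ 2` on the
left for `x' = x + (x - x ^ 2) w`. -/
theorem exists_correction_trans {x w w' : A} {x' : A} (hx' : x' = x + (x - x * x) * w)
    (h : IsIdempotentElem (x' + (x' - x' * x') * w')) :
    ∃ v, IsIdempotentElem (x + (x - x * x) * v) := by
  refine ⟨w + (1 - w * x) * (1 + (1 - x) * w) * w', ?_⟩
  have : x + (x - x * x) * (w + (1 - w * x) * (1 + (1 - x) * w) * w') =
      x' + (x' - x' * x') * w' := by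
    rw [hx']; noncomm_ring
  rwa [this]

theorem exists_correction_of_sq_zero {x : A} (h : (x - x * x) * (x - x * x) = 0) :
    ∃ v, IsIdempotentElem (x + (x - x * x) * v) := by
  refine ⟨2 * x - 1, ?_⟩
  have : (x + (x - x * x) * (2 * x - 1)) * (x + (x - x * x) * (2 * x - 1)) -
      (x + (x - x * x) * (2 * x - 1)) =
      (x - x * x) * (x - x * x) * (4 * x * x - 4 * x - 3) := by noncomm_ring
  rw [h, zero_mul, sub_eq_zero] at this
  exact this

/-- If `q = x - x ^ 2` is von Neumann regular, then `q A = h A` for an idempotent `h`, the right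
ideal `h A` is stable under `x`, and so `(1 - h) x (1 - h)` is an idempotent. -/
theorem exists_correction_of_regular {x k : A} (h : (x - x * x) * k * (x - x * x) = x - x * x) :
    ∃ v, IsIdempotentElem (x + (x - x * x) * v) := by
  obtain ⟨q, hq⟩ : ∃ q, q = x - x * x := ⟨_, rfl⟩
  rw [← hq] at h ⊢
  have hqx : x * q = q * x := by rw [hq]; noncomm_ring
  have hid : (1 - q * k) * q = 0 := by rw [sub_mul, one_mul, h, sub_self]
  have hid' : (1 - q * k) * x * (q * k) = 0 := by
    rw [mul_assoc, ← mul_assoc x, hqx, mul_assoc, ← mul_assoc, hid, zero_mul]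
  refine ⟨-(k * x) - x * k + k * x * (q * k), ?_⟩
  have h1 : x + q * (-(k * x) - x * k + k * x * (q * k)) = (1 - q * k) * x * (1 - q * k) := by
    calc _ = x - q * k * x - q * x * k + q * k * x * (q * k) := by noncomm_ring
      _ = _ := by rw [← hqx]; noncomm_ring
  have hidem : (1 - q * k) * (1 - q * k) = 1 - q * k := by
    calc _ = (1 - q * k) - (1 - q * k) * q * k := by noncomm_ring
      _ = _ := by rw [hid]; simp
  have hxx : (1 - q * k) * x * x = (1 - q * k) * x := by
    have : (1 - q * k) * (x - x * x) = 0 := by rw [← hq, hid]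
    rw [mul_sub, sub_eq_zero] at this
    rw [mul_assoc, this]
  rw [h1, IsIdempotentElem]
  calc (1 - q * k) * x * (1 - q * k) * ((1 - q * k) * x * (1 - q * k))
      = (1 - q * k) * x * ((1 - q * k) * (1 - q * k)) * (x * (1 - q * k)) := by noncomm_ring
    _ = (1 - q * k) * x * x * (1 - q * k) - (1 - q * k) * x * (q * k) * (x * (1 - q * k)) := by
        rw [hidem]; noncomm_ring
    _ = _ := by rw [hid', hxx]; simp

/-- The triangular case: `x` leaves the range of the idempotent `π` invariant, is idempotent there,
and its compression `a` to the complement has a von Neumann regular `a - a ^ 2`. After `a` has been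
made idempotent, `x - x ^ 2` squares to zero. -/
theorem exists_correction_of_triangular {x π k a : A} (hπ : IsIdempotentElem π)
    (hinv : π * x * π = x * π) (hid : x * x * π = x * π) (ha : a = (1 - π) * x * (1 - π))
    (hk : (a - a * a) * k * (a - a * a) = a - a * a) :
    ∃ v, IsIdempotentElem (x + (x - x * x) * v) := by
  obtain ⟨w, hw⟩ := exists_correction_of_regular hk
  obtain ⟨ρ, hρ⟩ : ∃ ρ, ρ = 1 - π := ⟨_, rfl⟩
  rw [← hρ] at ha
  have hρρ : ρ * ρ = ρ := by rw [hρ]; exact hπ.one_sub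
  have hρπ : ρ * π = 0 := by rw [hρ, sub_mul, one_mul, hπ.eq, sub_self]
  have hπρ : π + ρ = 1 := by rw [hρ]; abel
  have hρx : ρ * x = a := by
    have : ρ * x * π = 0 := by rw [mul_assoc, ← hinv, mul_assoc, ← mul_assoc, hρπ, zero_mul]
    calc ρ * x = ρ * x * (π + ρ) := by rw [hπρ, mul_one]
      _ = a := by rw [mul_add, this, zero_add, ha]
  have haρ : a * ρ = a := by rw [ha, mul_assoc, hρρ]
  have haρ' : (a - a * a) * ρ = a - a * a := by rw [sub_mul, mul_assoc, haρ]
  obtain ⟨E, hE⟩ : ∃ E, E = a + (a - a * a) * w := ⟨_, rfl⟩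
  rw [← hE] at hw
  obtain ⟨y, hy⟩ : ∃ y, y = x + (x - x * x) * (ρ * w * ρ) := ⟨_, rfl⟩
  have hρq : ρ * (x - x * x) = a - a * a := by
    have : a * x = a * a := by
      conv_lhs => rw [← haρ, mul_assoc, hρx]
    rw [mul_sub, ← mul_assoc, hρx, this]
  have hρy : ρ * y = E * ρ := by
    rw [hy, mul_add, ← mul_assoc, hρq, hρx, ← mul_assoc, ← mul_assoc, haρ', hE, add_mul, haρ]
  have hρqy : ρ * (y - y * y) = 0 := by
    rw [mul_sub, ← mul_assoc, hρy, mul_assoc, hρy, ← mul_assoc, hw.eq, sub_self]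
  have hyπ : y * π = x * π := by
    rw [hy, add_mul, mul_assoc, mul_assoc (ρ * w), hρπ, mul_zero, mul_zero, add_zero]
  have hqyπ : (y - y * y) * π = 0 := by
    rw [sub_mul, mul_assoc, hyπ, ← hinv, mul_assoc, ← mul_assoc y, hyπ, mul_assoc, ← mul_assoc π,
      hinv, ← mul_assoc, hid, sub_self]
  have hsq : (y - y * y) * (y - y * y) = 0 := by
    calc _ = (y - y * y) * (π + ρ) * (y - y * y) := by rw [hπρ, mul_one]
      _ = (y - y * y) * π * (y - y * y) + (y - y * y) * (ρ * (y - y * y)) := by noncomm_ring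
      _ = 0 := by rw [hqyπ, hρqy, zero_mul, mul_zero, add_zero]
  obtain ⟨v, hv⟩ := exists_correction_of_sq_zero hsq
  exact exists_correction_trans hy hv

/-- The decisive case. The subrings `A₀` and `A₁` stand for block diagonal operators with respect
to two interlaced partitions of the identity, and `M` for the projection to a neighbourhood of the
cuts of the first partition, so that `x` is block diagonal for the first partition away from `M`
and for the second partition on `M`.

Let `π` be an idempotent whose range is generated by `M` and `x M`. Inside the regular ring `A₁`
this range splits as `g A ⊕ (π - g) A` with `g ∈ x M A` and `π - g ∈ (1 - x) M A`. Replacing `x` by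
`g` on the range of `π` changes it by a multiple of `x - x ^ 2` only, and leaves an upper triangular
element whose second diagonal entry is in the regular ring `A₀`. -/
theorem exists_correction_of_regular_subrings (A₀ A₁ : Subring A)
    (h₀ : ∀ a ∈ A₀, ∃ k, a * k * a = a) (h₁ : ∀ a ∈ A₁, ∃ k ∈ A₁, a * k * a = a)
    (h₂ : ∀ a ∈ A₀ ⊓ A₁, ∃ k ∈ A₀ ⊓ A₁, a * k * a = a) {x M : A} (hM : IsIdempotentElem M)
    (hMA : M ∈ A₀ ⊓ A₁) (hx₀ : (1 - M) * x ∈ A₀) (hx₁ : x * M ∈ A₁) :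
    ∃ v, IsIdempotentElem (x + (x - x * x) * v) := by
  obtain ⟨hM₀, hM₁⟩ := Subring.mem_inf.1 hMA
  have hM' : (1 - M) * M = 0 := by rw [sub_mul, one_mul, hM.eq, sub_self]
  have hM'' : M * (1 - M) = 0 := by rw [mul_sub, mul_one, hM.eq, sub_self]
  obtain ⟨t, ht⟩ : ∃ t, t = (1 - M) * x * M := ⟨_, rfl⟩
  have htA : t ∈ A₀ ⊓ A₁ := by
    refine Subring.mem_inf.2 ⟨ht ▸ A₀.mul_mem hx₀ hM₀, ?_⟩
    rw [ht, mul_assoc]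
    exact A₁.mul_mem (A₁.sub_mem A₁.one_mem hM₁) hx₁
  obtain ⟨k, hkA, hk⟩ := h₂ t htA
  obtain ⟨π, hπd⟩ : ∃ π, π = M + t * k * (1 - M) := ⟨_, rfl⟩
  have hπA : π ∈ A₀ ⊓ A₁ := hπd ▸ add_mem hMA
    (mul_mem (mul_mem htA hkA) (sub_mem (one_mem _) hMA))
  obtain ⟨hπ₀, hπ₁⟩ := Subring.mem_inf.1 hπA
  have hMt : M * t = 0 := by rw [ht, ← mul_assoc, ← mul_assoc, hM'', zero_mul, zero_mul]
  have hπM : π * M = M := by rw [hπd, add_mul, mul_assoc, hM', mul_zero, add_zero, hM.eq]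
  have hπt : π * t = t := by
    rw [hπd, add_mul, hMt, zero_add, mul_assoc, sub_mul, one_mul, hMt, sub_zero, hk]
  have hπ : π * π = π := by
    nth_rewrite 2 [hπd]
    rw [mul_add, hπM, ← mul_assoc, ← mul_assoc, hπt, ← hπd]
  have hxMt : x * M = M * x * M + t := by rw [ht]; noncomm_ring
  have hπxM : π * (x * M) = x * M := by
    rw [hxMt, mul_add, hπt, ← mul_assoc, ← mul_assoc, hπM]
  obtain ⟨b, hb⟩ : ∃ b, b = x * M := ⟨_, rfl⟩
  obtain ⟨c, hc⟩ : ∃ c, c = (1 - x) * M := ⟨_, rfl⟩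
  have hbcM : b + c = M := by rw [hb, hc]; noncomm_ring
  have hπb : π * b = b := by rw [hb, hπxM]
  have hπc : π * c = c := by
    rw [eq_sub_of_add_eq' hbcM, mul_sub, hπM, hπb]
  have hbA : b ∈ A₁ := hb ▸ hx₁
  have hcA : c ∈ A₁ := by
    rw [eq_sub_of_add_eq' hbcM]; exact sub_mem hM₁ hbA
  -- `f` is an idempotent with range `(1 - x) M A`
  obtain ⟨k', hk'A, hk'⟩ := h₁ c hcA
  obtain ⟨f, hf⟩ : ∃ f, f = c * k' * π := ⟨_, rfl⟩
  have hfc : f * c = c := by rw [hf, mul_assoc, hπc, hk']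
  have hπf : π * f = f := by rw [hf, ← mul_assoc, ← mul_assoc, hπc]
  have hfπ : f * π = f := by rw [hf, mul_assoc, hπ]
  have hff : f * f = f := by
    nth_rewrite 2 [hf]
    rw [← mul_assoc, ← mul_assoc, hfc, ← hf]
  have hfA : f ∈ A₁ := hf ▸ mul_mem (mul_mem hcA hk'A) hπ₁
  obtain ⟨j, -, hj⟩ := h₁ ((π - f) * b) (mul_mem (sub_mem hπ₁ hfA) hbA)
  -- `g` is the idempotent with kernel `(1 - x) M A ⊕ (1 - π) A` and range inside `x M A`
  obtain ⟨g, hg⟩ : ∃ g, g = b * j * (π - f) := ⟨_, rfl⟩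
  have hπfc : (π - f) * c = 0 := by rw [sub_mul, hπc, hfc, sub_self]
  have hgb : (π - f) * g * b = (π - f) * b := by
    rw [hg, ← hj]; noncomm_ring
  have hgc : (π - f) * g * c = (π - f) * c := by
    rw [hg, hπfc, mul_assoc, mul_assoc, hπfc, mul_zero, mul_zero]
  have hgM : (π - f) * g * M = (π - f) * M := by
    rw [← hbcM, mul_add, mul_add, hgb, hgc]
  have hgt : (π - f) * g * t = (π - f) * t := by
    have : t = b - M * x * M := by rw [hb, hxMt]; abel
    rw [this, mul_sub, mul_sub, hgb, mul_assoc M, ← mul_assoc _ M, hgM, mul_assoc _ M]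
  have hπff : (π - f) * π = π - f := by rw [sub_mul, hπ, hfπ]
  have hgπ' : (π - f) * g * π = (π - f) * π := by
    have h (u : A) : u * π = u * M + u * t * k * (1 - M) := by rw [hπd]; noncomm_ring
    rw [h, h (π - f), hgM, hgt]
  have hgπ : g * π = g := by rw [hg, mul_assoc, hπff]
  have hfg : (π - f) * g = π - f := by
    rw [mul_assoc, hgπ, hπff] at hgπ'; exact hgπ'
  have hπg : π * g = g := by rw [hg, ← mul_assoc, ← mul_assoc, hπb]
  have hgg : g * g = g := by
    have : g * f = 0 := by
      rw [hg, mul_assoc, sub_mul, hπf, hff, sub_self, mul_zero]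
    calc g * g = g * ((π - f) * g) := by rw [sub_mul, hπg, mul_sub, ← mul_assoc g f, this]; simp
      _ = g := by rw [hfg, mul_sub, hgπ, this, sub_zero]
  have hgx : g = x * M * (j * (π - f)) := by rw [hg, hb, mul_assoc]
  have hgx' : π - g = (1 - x) * M * (k' * π * (π - g)) := by
    have : (π - f) * (π - g) = 0 := by rw [mul_sub, hπff, hfg, sub_self]
    rw [sub_mul, sub_eq_zero, mul_sub, hπ, hπg] at this
    rw [← hc, ← mul_assoc, ← mul_assoc, ← hf]
    exact this
  obtain ⟨x', hx'⟩ : ∃ x', x' = x * (1 - π) + g := ⟨_, rfl⟩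
  -- from `g ∈ x M A` and `π - g ∈ (1 - x) M A` one gets `g - x π ∈ (x - x ^ 2) A`
  obtain ⟨w, hxx'⟩ : ∃ w, x' = x + (x - x * x) * w := by
    generalize j * (π - f) = u at hgx
    generalize k' * π * (π - g) = u' at hgx'
    refine ⟨M * u - M * u', ?_⟩
    calc x' = x + ((1 - x) * g - x * (π - g)) := by rw [hx']; noncomm_ring
      _ = x + ((1 - x) * (x * M * u) - x * ((1 - x) * M * u')) := by rw [← hgx, ← hgx']
      _ = _ := by noncomm_ring
  have hx'π : x' * π = g := by
    rw [hx', add_mul, mul_assoc, sub_mul, one_mul, hπ, sub_self, mul_zero, zero_add, hgπ]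
  have hx'g : x' * g = g := by
    conv_lhs => rw [← hπg, ← mul_assoc, hx'π, hgg]
  have hcomp : (1 - π) * x' * (1 - π) ∈ A₀ := by
    have h1 : (1 - π) * (1 - M) = 1 - π := by
      rw [mul_sub, mul_one, sub_mul, one_mul, hπM, sub_self, sub_zero]
    have h2 : (1 - π) * g = 0 := by rw [sub_mul, one_mul, hπg, sub_self]
    have h3 : (1 - π) * x' * (1 - π) = (1 - π) * ((1 - M) * x) * ((1 - π) * (1 - π)) := by
      rw [← mul_assoc _ (1 - M), h1, hx', mul_add, h2]; noncomm_ring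
    rw [h3]
    have := sub_mem A₀.one_mem hπ₀
    exact mul_mem (mul_mem this hx₀) (mul_mem this this)
  obtain ⟨l, hl⟩ := h₀ _ (sub_mem hcomp (mul_mem hcomp hcomp))
  obtain ⟨v, hv⟩ := exists_correction_of_triangular (x := x') hπ
    (by rw [mul_assoc, hx'π, hπg]) (by rw [mul_assoc, hx'π, hx'g]) rfl hl
  exact exists_correction_trans hxx' hv

end Correction

/-! ### Strict exhaustions -/

/-- An increasing sequence of idempotents of a unital ring `A` that behaves like an approximate unit
of a regular ring `S` in the multiplier ring `A` of `S`. The elements `a` with `e n * a * e n = a`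
for some `n` play the role of `S`; the convergence in `exists_sum` is the strict one. -/
structure IsStrictExhaustion {A : Type*} [Ring A] (e : ℕ → A) : Prop where
  zero : e 0 = 0
  mul_of_le : ∀ {m n}, m ≤ n → e m * e n = e m
  mul_of_le' : ∀ {m n}, m ≤ n → e n * e m = e m
  eq_zero : ∀ a, (∀ n, a * e n = 0) → a = 0
  exists_left : ∀ a n, ∃ k, e k * (a * e n) = a * e n
  exists_right : ∀ a n, ∃ k, e n * a * e k = e n * a
  regular : ∀ n a, e n * a = a → a * e n = a → ∃ y, a * y * a = a
  exists_sum : ∀ c : ℕ → A, (∀ k, ∀ᶠ n in Filter.atTop, e k * c n = 0 ∧ c n * e k = 0) →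
    ∃ a, ∀ k, ∀ᶠ N in Filter.atTop,
      a * e k = (∑ i ∈ Finset.range N, c i) * e k ∧ e k * a = e k * ∑ i ∈ Finset.range N, c i

namespace IsStrictExhaustion

variable {A : Type u} [Ring A] {e : ℕ → A}

theorem commute (h : IsStrictExhaustion e) (m n : ℕ) : e m * e n = e n * e m := by
  rcases le_total m n with hmn | hmn
  · rw [h.mul_of_le hmn, h.mul_of_le' hmn]
  · rw [h.mul_of_le hmn, h.mul_of_le' hmn]

theorem idem (h : IsStrictExhaustion e) (n : ℕ) : e n * e n = e n := h.mul_of_le le_rfl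

theorem left_of_le (h : IsStrictExhaustion e) {a : A} {m n : ℕ} (hmn : m ≤ n) (ha : e m * a = a) :
    e n * a = a := by
  rw [← ha, ← mul_assoc, h.mul_of_le' hmn]

theorem right_of_le (h : IsStrictExhaustion e) {a : A} {m n : ℕ} (hmn : m ≤ n) (ha : a * e m = a) :
    a * e n = a := by
  rw [← ha, mul_assoc, h.mul_of_le hmn]

theorem left_eq_zero_of_le (h : IsStrictExhaustion e) {a : A} {m n : ℕ} (hmn : m ≤ n)
    (ha : e n * a = 0) : e m * a = 0 := by
  rw [← h.mul_of_le hmn, mul_assoc, ha, mul_zero]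

theorem right_eq_zero_of_le (h : IsStrictExhaustion e) {a : A} {m n : ℕ} (hmn : m ≤ n)
    (ha : a * e n = 0) : a * e m = 0 := by
  rw [← h.mul_of_le' hmn, ← mul_assoc, ha, zero_mul]

theorem subsequence (h : IsStrictExhaustion e) {φ : ℕ → ℕ} (hφ : StrictMono φ) (h0 : φ 0 = 0) :
    IsStrictExhaustion fun n => e (φ n) where
  zero := by rw [h0, h.zero]
  mul_of_le hmn := h.mul_of_le (hφ.monotone hmn)
  mul_of_le' hmn := h.mul_of_le' (hφ.monotone hmn)
  eq_zero a ha := h.eq_zero a fun n => h.right_eq_zero_of_le hφ.le_apply (ha n)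
  exists_left a n := by
    obtain ⟨k, hk⟩ := h.exists_left a (φ n)
    exact ⟨k, h.left_of_le hφ.le_apply hk⟩
  exists_right a n := by
    obtain ⟨k, hk⟩ := h.exists_right a (φ n)
    exact ⟨k, h.right_of_le hφ.le_apply hk⟩
  regular n := h.regular (φ n)
  exists_sum c hc := by
    obtain ⟨a, ha⟩ := h.exists_sum c fun k => by
      filter_upwards [hc k] with n hn
      exact ⟨h.left_eq_zero_of_le hφ.le_apply hn.1, h.right_eq_zero_of_le hφ.le_apply hn.2⟩
    exact ⟨a, fun k => ha (φ k)⟩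

theorem ext_blocks (h : IsStrictExhaustion e) {a b : A}
    (hab : ∀ n, a * (e (n + 1) - e n) = b * (e (n + 1) - e n)) : a = b := by
  refine sub_eq_zero.1 (h.eq_zero _ fun n => ?_)
  induction n with
  | zero => rw [h.zero, mul_zero]
  | succ n ih =>
    have := sub_eq_zero.2 (hab n)
    rw [← sub_mul, mul_sub, ih, sub_zero] at this
    exact this

theorem mul_block_of_le (h : IsStrictExhaustion e) {m n : ℕ} (hmn : m ≤ n) :
    e m * (e (n + 1) - e n) = 0 := by
  rw [mul_sub, h.mul_of_le hmn, h.mul_of_le (hmn.trans n.le_succ), sub_self]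

theorem block_mul_of_le (h : IsStrictExhaustion e) {m n : ℕ} (hmn : m ≤ n) :
    (e (n + 1) - e n) * e m = 0 := by
  rw [sub_mul, h.mul_of_le' hmn, h.mul_of_le' (hmn.trans n.le_succ), sub_self]

/-- Blocks can be assembled to a block diagonal element. -/
theorem exists_blockDiagonal (h : IsStrictExhaustion e) (c : ℕ → A)
    (hl : ∀ n, e (n + 1) * c n = c n) (hr : ∀ n, c n * e (n + 1) = c n)
    (hl0 : ∀ n, e n * c n = 0) (hr0 : ∀ n, c n * e n = 0) :
    ∃ a ∈ Subring.centralizer (Set.range e), ∀ n, a * (e (n + 1) - e n) = c n := by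
  obtain ⟨a, ha⟩ := h.exists_sum c fun k => by
    filter_upwards [Filter.eventually_ge_atTop k] with n hn
    exact ⟨h.left_eq_zero_of_le hn (hl0 n), h.right_eq_zero_of_le hn (hr0 n)⟩
  have key : ∀ k, a * e k = ∑ i ∈ Finset.range k, c i ∧ e k * a = ∑ i ∈ Finset.range k, c i := by
    intro k
    obtain ⟨N, ⟨hN, hN'⟩, hkN⟩ := ((ha k).and (Filter.eventually_ge_atTop k)).exists
    rw [hN, hN', Finset.sum_mul, Finset.mul_sum, ← Finset.sum_range_add_sum_Ico _ hkN,
      ← Finset.sum_range_add_sum_Ico (fun i => e k * c i) hkN]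
    refine ⟨?_, ?_⟩
    · rw [Finset.sum_eq_zero (s := Finset.Ico k N), add_zero]
      · exact Finset.sum_congr rfl fun i hi =>
          h.right_of_le (Finset.mem_range.1 hi) (hr i)
      · exact fun i hi => h.right_eq_zero_of_le (Finset.mem_Ico.1 hi).1 (hr0 i)
    · rw [Finset.sum_eq_zero (s := Finset.Ico k N), add_zero]
      · exact Finset.sum_congr rfl fun i hi =>
          h.left_of_le (Finset.mem_range.1 hi) (hl i)
      · exact fun i hi => h.left_eq_zero_of_le (Finset.mem_Ico.1 hi).1 (hl0 i)
  refine ⟨a, Subring.mem_centralizer_iff.2 ?_, fun n => ?_⟩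
  · rintro _ ⟨k, rfl⟩
    rw [(key k).1, (key k).2]
  · rw [mul_sub, (key _).1, (key _).1, Finset.sum_range_succ, add_sub_cancel_left]

/-- The ring of block diagonal elements is von Neumann regular. -/
theorem regular_centralizer (h : IsStrictExhaustion e) {a : A}
    (ha : a ∈ Subring.centralizer (Set.range e)) :
    ∃ k ∈ Subring.centralizer (Set.range e), a * k * a = a := by
  have hcomm : ∀ n, e n * a = a * e n := fun n => Subring.mem_centralizer_iff.1 ha _ ⟨n, rfl⟩
  obtain ⟨D, hD⟩ : ∃ D : ℕ → A, ∀ n, D n = e (n + 1) - e n := ⟨_, fun _ => rfl⟩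
  have hDa : ∀ n, D n * a = a * D n := fun n => by rw [hD, sub_mul, mul_sub, hcomm, hcomm]
  have heD : ∀ n, e (n + 1) * D n = D n := fun n => by
    rw [hD, mul_sub, h.idem, h.mul_of_le' n.le_succ]
  have hDe : ∀ n, D n * e (n + 1) = D n := fun n => by
    rw [hD, sub_mul, h.idem, h.mul_of_le n.le_succ]
  have heD0 : ∀ n, e n * D n = 0 := fun n => by rw [hD, h.mul_block_of_le le_rfl]
  have hDe0 : ∀ n, D n * e n = 0 := fun n => by rw [hD, h.block_mul_of_le le_rfl]
  have hreg : ∀ n, ∃ y, (a * D n) * y * (a * D n) = a * D n := fun n =>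
    h.regular (n + 1) _ (by rw [← mul_assoc, hcomm, mul_assoc, heD]) (by rw [mul_assoc, hDe])
  choose y hy using hreg
  obtain ⟨k, hk, hkD⟩ := h.exists_blockDiagonal (fun n => D n * y n * D n)
    (fun n => by rw [← mul_assoc, ← mul_assoc, heD]) (fun n => by rw [mul_assoc, hDe])
    (fun n => by rw [← mul_assoc, ← mul_assoc, heD0, zero_mul, zero_mul])
    (fun n => by rw [mul_assoc, hDe0, mul_zero])
  refine ⟨k, hk, h.ext_blocks fun n => ?_⟩
  rw [← hD]
  simp only [← hD] at hkD
  calc a * k * a * D n = a * (k * D n) * a := by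
        rw [mul_assoc, ← hDa]; noncomm_ring
    _ = a * D n * y n * (D n * a) := by rw [hkD]; noncomm_ring
    _ = a * D n := by rw [hDa, hy]

/-- Along a suitable subsequence a given element becomes block tridiagonal. -/
theorem exists_tridiagonal (h : IsStrictExhaustion e) (x : A) :
    ∃ φ : ℕ → ℕ, StrictMono φ ∧ φ 0 = 0 ∧
      (∀ n, e (φ (n + 1)) * (x * e (φ n)) = x * e (φ n)) ∧
      ∀ n, e (φ n) * x * e (φ (n + 1)) = e (φ n) * x := by
  have : ∀ n, ∃ k, n < k ∧ e k * (x * e n) = x * e n ∧ e n * x * e k = e n * x := by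
    intro n
    obtain ⟨k, hk⟩ := h.exists_left x n
    obtain ⟨l, hl⟩ := h.exists_right x n
    refine ⟨max (n + 1) (max k l), by omega, h.left_of_le (by omega) hk,
      h.right_of_le (by omega) hl⟩
  choose K hK hl hr using this
  let φ : ℕ → ℕ := fun n => Nat.rec 0 (fun _ k => K k) n
  exact ⟨φ, strictMono_nat_of_lt_succ fun n => hK (φ n), rfl, fun n => hl (φ n), fun n => hr (φ n)⟩

/-- For block tridiagonal `x` with respect to `e`, the cuts are placed at `e (4 n + 2)` for the
first partition and at `e (4 n)` for the second one, and `M` is the sum of the idempotents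
`e (4 n + 3) - e (4 n + 1)` around the cuts of the first partition. -/
theorem exists_correction_of_tridiagonal (h : IsStrictExhaustion e) {x : A}
    (hl : ∀ n, e (n + 1) * (x * e n) = x * e n) (hr : ∀ n, e n * x * e (n + 1) = e n * x) :
    ∃ v, IsIdempotentElem (x + (x - x * x) * v) := by
  have hl' {m n : ℕ} (hmn : m < n) : e n * (x * e m) = x * e m := h.left_of_le hmn (hl _)
  have hr' {m n : ℕ} (hmn : m < n) : e m * x * e n = e m * x := h.right_of_le hmn (hr _)
  have s₀ : IsStrictExhaustion fun n => e (4 * n - 2) :=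
    h.subsequence (φ := fun n => 4 * n - 2) (fun a b hab => by dsimp only; omega) rfl
  have s₁ : IsStrictExhaustion fun n => e (4 * n) :=
    h.subsequence (φ := fun n => 4 * n) (fun a b hab => by dsimp only; omega) rfl
  have s₂ : IsStrictExhaustion fun n => e (2 * n) :=
    h.subsequence (φ := fun n => 2 * n) (fun a b hab => by dsimp only; omega) rfl
  have mem₂ : Subring.centralizer (Set.range fun n => e (4 * n - 2)) ⊓
      Subring.centralizer (Set.range fun n => e (4 * n)) =
      Subring.centralizer (Set.range fun n => e (2 * n)) := by
    ext a
    simp only [Subring.mem_inf, Subring.mem_centralizer_iff, Set.forall_mem_range]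
    refine ⟨fun ⟨ha, hb⟩ n => ?_, fun ha => ⟨fun n => ?_, fun n => ?_⟩⟩
    · obtain ⟨k, rfl | rfl⟩ := n.even_or_odd'
      · rw [← mul_assoc]; exact hb k
      · have := ha (k + 1)
        rwa [show 4 * (k + 1) - 2 = 2 * (2 * k + 1) by omega] at this
    · rw [show 4 * n - 2 = 2 * (2 * n - 1) by omega]; exact ha _
    · rw [show 4 * n = 2 * (2 * n) by omega]; exact ha _
  obtain ⟨P, hP⟩ : ∃ P : ℕ → A, ∀ n, P n = e (4 * n + 3) - e (4 * n + 1) := ⟨_, fun _ => rfl⟩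
  have heP : ∀ {m n}, 4 * n + 3 ≤ m → e m * P n = P n := fun hmn => by
    rw [hP, mul_sub, h.mul_of_le' hmn, h.mul_of_le' (by omega)]
  have hPe : ∀ {m n}, 4 * n + 3 ≤ m → P n * e m = P n := fun hmn => by
    rw [hP, sub_mul, h.mul_of_le hmn, h.mul_of_le (by omega)]
  have heP0 : ∀ {m n}, m ≤ 4 * n + 1 → e m * P n = 0 := fun hmn => by
    rw [hP, mul_sub, h.mul_of_le hmn, h.mul_of_le (by omega), sub_self]
  have hPe0 : ∀ {m n}, m ≤ 4 * n + 1 → P n * e m = 0 := fun hmn => by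
    rw [hP, sub_mul, h.mul_of_le' hmn, h.mul_of_le' (by omega), sub_self]
  obtain ⟨M, -, hMP⟩ := s₁.exists_blockDiagonal P (fun n => heP (by omega))
    (fun n => hPe (by omega)) (fun n => heP0 (by omega)) (fun n => hPe0 (by omega))
  have hPD : ∀ n, (e (4 * (n + 1)) - e (4 * n)) * P n = P n := fun n => by
    rw [sub_mul, heP (by omega), heP0 (by omega), sub_zero]
  have hMPP : ∀ n, M * P n = P n := fun n => by
    have hPP : P n * P n = P n := by
      nth_rewrite 1 [hP]
      rw [sub_mul, heP le_rfl, heP0 le_rfl, sub_zero]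
    rw [← hPD, ← mul_assoc, hMP, hPP, hPD]
  have hM : IsIdempotentElem M := s₁.ext_blocks fun n => by
    rw [mul_assoc, hMP, hMPP]
  have hMe : ∀ n, e n * M = M * e n := fun n => s₁.ext_blocks fun k => by
    have hc : ∀ i, e i * e n = e n * e i := fun i => h.commute i n
    have h1 : (e (4 * (k + 1)) - e (4 * k)) * e n = e n * (e (4 * (k + 1)) - e (4 * k)) := by
      rw [sub_mul, mul_sub, hc, hc]
    have h2 : P k * e n = e n * P k := by rw [hP, sub_mul, mul_sub, hc, hc]
    rw [mul_assoc, hMP, mul_assoc, ← h1, ← mul_assoc, hMP, h2]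
  have hM₂ : M ∈ Subring.centralizer (Set.range fun n => e (4 * n - 2)) ⊓
      Subring.centralizer (Set.range fun n => e (4 * n)) := by
    rw [mem₂, Subring.mem_centralizer_iff]
    rintro _ ⟨n, rfl⟩
    exact hMe _
  refine exists_correction_of_regular_subrings
    (Subring.centralizer (Set.range fun n => e (4 * n - 2)))
    (Subring.centralizer (Set.range fun n => e (4 * n)))
    (fun a ha => (s₀.regular_centralizer ha).imp fun k hk => hk.2)
    (fun a ha => s₁.regular_centralizer ha)
    (fun a ha => by rw [mem₂] at ha ⊢; exact s₂.regular_centralizer ha) (x := x) hM hM₂ ?_ ?_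
  · -- `x` fails to commute with a cut only in the two neighbouring blocks, which lie under `M`
    have key : ∀ n, (1 - M) * (e (4 * n + 2) * x - x * e (4 * n + 2)) = 0 := by
      intro n
      have h1 : P n * (e (4 * n + 2) * x - x * e (4 * n + 2)) =
          e (4 * n + 2) * x - x * e (4 * n + 2) := by
        have a1 : e (4 * n + 3) * (e (4 * n + 2) * x) = e (4 * n + 2) * x := by
          rw [← mul_assoc, h.mul_of_le' (by omega)]
        have a2 : e (4 * n + 1) * (e (4 * n + 2) * x) = e (4 * n + 1) * x := by
          rw [← mul_assoc, h.mul_of_le (by omega)]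
        have a3 : e (4 * n + 1) * (x * e (4 * n + 2)) = e (4 * n + 1) * x := by
          rw [← mul_assoc, hr]
        rw [hP, sub_mul, mul_sub, mul_sub, a1, a2, a3, hl, sub_self, sub_zero]
      rw [← h1, ← mul_assoc, sub_mul, one_mul, hMPP, sub_self, zero_mul]
    refine Subring.mem_centralizer_iff.2 ?_
    rintro _ ⟨n, rfl⟩
    rcases n with _ | n
    · simp [h.zero]
    · have := key n
      rw [mul_sub, sub_eq_zero] at this
      dsimp only
      rw [show 4 * (n + 1) - 2 = 4 * n + 2 by omega, mul_assoc, ← this, ← mul_assoc, ← mul_assoc,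
        mul_sub, sub_mul 1 M, hMe, mul_one, one_mul]
  · refine Subring.mem_centralizer_iff.2 ?_
    rintro _ ⟨m, rfl⟩
    refine s₁.ext_blocks fun n => ?_
    have hD : (e (4 * (n + 1)) - e (4 * n)) * e (4 * m) =
        e (4 * m) * (e (4 * (n + 1)) - e (4 * n)) := by
      rw [sub_mul, mul_sub, h.commute, h.commute (4 * m) (4 * n)]
    have e1 : e (4 * m) * (x * M) * (e (4 * (n + 1)) - e (4 * n)) = e (4 * m) * (x * P n) := by
      rw [← hMP]; noncomm_ring
    have e2 : x * M * e (4 * m) * (e (4 * (n + 1)) - e (4 * n)) = x * (P n * e (4 * m)) := by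
      rw [mul_assoc, ← hD, ← mul_assoc, mul_assoc x, hMP, mul_assoc]
    dsimp only
    rw [e1, e2]
    rcases le_or_gt m n with hmn | hmn
    · rw [hPe0 (by omega), mul_zero, ← mul_assoc, ← hr' (show 4 * m < 4 * n + 1 by omega),
        mul_assoc, heP0 le_rfl, mul_zero]
    · rw [hPe (by omega)]
      have : P n = e (4 * n + 3) * P n := (heP le_rfl).symm
      rw [this, ← mul_assoc x, ← mul_assoc, hl' (by omega)]

/-- A ring with a strict exhaustion is an exchange ring. -/
theorem isExchangeRing (h : IsStrictExhaustion e) : IsExchangeRing A := by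
  refine isExchangeRing_iff_exists_pair.2 fun x => ?_
  obtain ⟨φ, hφ, h0, hl, hr⟩ := h.exists_tridiagonal x
  obtain ⟨v, hv⟩ := (h.subsequence hφ h0).exists_correction_of_tridiagonal hl hr
  exact exists_isExchangePair_of_correction hv

/-- A ring homomorphism that carries a strict exhaustion to a strict exhaustion is surjective as
soon as it is surjective on corners: for `b` in the target, the differences `d n` of the corners of
`b` are lifted in such a way that the lifts are strictly summable. -/
theorem surjective_of_corners {B : Type*} [Ring B] (f : A →+* B) (hA : IsStrictExhaustion e)
    (hB : IsStrictExhaustion fun n => f (e n))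
    (hf : ∀ n b, f (e n) * b = b → b * f (e n) = b → ∃ a, f a = b) : Function.Surjective f := by
  intro b
  obtain ⟨d, hd⟩ : ∃ d : ℕ → B, ∀ n, d n = f (e (n + 1)) * b * f (e (n + 1)) -
      f (e n) * b * f (e n) := ⟨_, fun _ => rfl⟩
  have hsum : ∀ N, ∑ i ∈ Finset.range N, d i = f (e N) * b * f (e N) := fun N => by
    rw [Finset.sum_congr rfl fun i _ => hd i, Finset.sum_range_sub (fun i => f (e i) * b * f (e i)),
      hA.zero, map_zero, mul_zero, sub_zero]
  have hd0 : ∀ k, ∀ᶠ n in Filter.atTop, f (e k) * d n = 0 ∧ d n * f (e k) = 0 := by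
    intro k
    obtain ⟨l, hl⟩ := hB.exists_left b k
    obtain ⟨r, hr⟩ := hB.exists_right b k
    filter_upwards [Filter.eventually_ge_atTop (max k (max l r))] with n hn
    have h1 : ∀ {m}, n ≤ m → f (e k) * (f (e m) * b * f (e m)) = f (e k) * b := fun {m} hm => by
      rw [← mul_assoc, ← mul_assoc, hB.mul_of_le (show k ≤ m by omega)]
      exact hB.right_of_le (by omega) hr
    have h2 : ∀ {m}, n ≤ m → f (e m) * b * f (e m) * f (e k) = b * f (e k) := fun {m} hm => by
      rw [mul_assoc, hB.mul_of_le' (show k ≤ m by omega), mul_assoc]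
      exact hB.left_of_le (by omega) hl
    rw [hd, mul_sub, sub_mul, h1 le_rfl, h1 n.le_succ, h2 le_rfl, h2 n.le_succ, sub_self, sub_self]
    exact ⟨rfl, rfl⟩
  -- `j n` is the largest index up to `n` for which `d n` is orthogonal to `f (e (j n))`
  classical
  obtain ⟨j, hj⟩ : ∃ j : ℕ → ℕ, ∀ n, j n =
      Nat.findGreatest (fun k => f (e k) * d n = 0 ∧ d n * f (e k) = 0) n := ⟨_, fun _ => rfl⟩
  have hjd : ∀ n, f (e (j n)) * d n = 0 ∧ d n * f (e (j n)) = 0 := fun n => by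
    rw [hj]
    exact Nat.findGreatest_spec (P := fun k => f (e k) * d n = 0 ∧ d n * f (e k) = 0)
      n.zero_le (by simp [hA.zero])
  have hjk : ∀ k, ∀ᶠ n in Filter.atTop, k ≤ j n := by
    intro k
    filter_upwards [hd0 k, Filter.eventually_ge_atTop k] with n hn hkn
    rw [hj]
    exact Nat.le_findGreatest hkn hn
  have hlift : ∀ n, ∃ c, f c = d n ∧ e (j n) * c = 0 ∧ c * e (j n) = 0 := by
    intro n
    obtain ⟨c, hc⟩ := hf (n + 1) (d n)
      (by
        rw [hd, mul_sub, ← mul_assoc, ← mul_assoc, ← mul_assoc, ← mul_assoc, hB.idem,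
          hB.mul_of_le' n.le_succ])
      (by
        rw [hd, sub_mul, mul_assoc, mul_assoc _ (f (e n)), hB.idem, hB.mul_of_le n.le_succ])
    refine ⟨(1 - e (j n)) * c * (1 - e (j n)), ?_, ?_, ?_⟩
    · rw [map_mul, map_mul, map_sub, map_one, hc, sub_mul, (hjd n).1, one_mul, sub_zero, mul_sub,
        mul_one, (hjd n).2, sub_zero]
    · rw [← mul_assoc, ← mul_assoc, mul_sub (e (j n)) 1 (e (j n)), mul_one, hA.idem, sub_self,
        zero_mul, zero_mul]
    · rw [mul_assoc, sub_mul 1 (e (j n)) (e (j n)), one_mul, hA.idem, sub_self, mul_zero]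
  choose c hc hcl hcr using hlift
  obtain ⟨a, ha⟩ := hA.exists_sum c fun k => by
    filter_upwards [hjk k] with n hn
    exact ⟨hA.left_eq_zero_of_le hn (hcl n), hA.right_eq_zero_of_le hn (hcr n)⟩
  refine ⟨a, sub_eq_zero.1 (hB.eq_zero _ fun k => ?_)⟩
  obtain ⟨l, hl⟩ := hB.exists_left b k
  obtain ⟨N, ⟨hN, -⟩, hkN⟩ := ((ha k).and (Filter.eventually_ge_atTop (max k l))).exists
  rw [sub_mul, sub_eq_zero, ← map_mul, hN, map_mul, map_sum, Finset.sum_congr rfl fun i _ => hc i,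
    hsum, mul_assoc, hB.mul_of_le' (show k ≤ N by omega), mul_assoc]
  exact hB.left_of_le (by omega) hl

end IsStrictExhaustion

/-! ### Local units in von Neumann regular rings -/

section LocalUnits

variable {S : Type u} [NonUnitalRing S]

theorem IsVonNeumannRegularRing.exists_left_unit (hS : IsVonNeumannRegularRing S) {g : S}
    (hg : g * g = g) (b : S) :
    ∃ h, h * h = h ∧ h * g = g ∧ h * b = b := by
  obtain ⟨y, hy⟩ := hS (b - g * b)
  obtain ⟨c, hc⟩ : ∃ c, c = b - g * b := ⟨_, rfl⟩
  rw [← hc] at hy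
  have hgc : g * c = 0 := by rw [hc, mul_sub, ← mul_assoc, hg, sub_self]
  obtain ⟨p, hp⟩ : ∃ p, p = c * y := ⟨_, rfl⟩
  rw [← hp] at hy
  have hgp : g * p = 0 := by rw [hp, ← mul_assoc, hgc, zero_mul]
  have hpp : p * p = p := by
    nth_rewrite 2 [hp]
    rw [← mul_assoc, ← hy, ← hp]
  have h1 : (g + p - p * g) * g = g := by rw [sub_mul, add_mul, mul_assoc, hg, add_sub_cancel_right]
  have h2 : (g + p - p * g) * p = p := by
    rw [sub_mul, add_mul, mul_assoc, hgp, hpp, mul_zero, zero_add, sub_zero]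
  refine ⟨g + p - p * g, ?_, h1, ?_⟩
  · rw [mul_sub, mul_add, h1, h2, ← mul_assoc, h2]
  · have h3 : (g + p - p * g) * c = c := by
      rw [sub_mul, add_mul, mul_assoc, hgc, ← hy, mul_zero, zero_add, sub_zero]
    have h4 : b = g * b + c := by rw [hc, add_sub_cancel]
    rw [h4, mul_add, h3, ← mul_assoc, h1]

theorem IsVonNeumannRegularRing.exists_right_unit (hS : IsVonNeumannRegularRing S) {g : S}
    (hg : g * g = g) (b : S) :
    ∃ h, h * h = h ∧ g * h = g ∧ b * h = b := by
  have hop : IsVonNeumannRegularRing Sᵐᵒᵖ := fun x => by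
    obtain ⟨y, hy⟩ := hS x.unop
    exact ⟨MulOpposite.op y, MulOpposite.unop_injective (by
      rw [MulOpposite.unop_mul, MulOpposite.unop_mul, MulOpposite.unop_op, ← mul_assoc]
      exact hy)⟩
  obtain ⟨h, h1, h2, h3⟩ := hop.exists_left_unit (g := MulOpposite.op g)
    (MulOpposite.unop_injective hg) (MulOpposite.op b)
  exact ⟨h.unop, congrArg MulOpposite.unop h1, congrArg MulOpposite.unop h2,
    congrArg MulOpposite.unop h3⟩

/-- A left unit `h` for two elements and a right unit `k` for these elements and `h` combine to the
two-sided unit `h + k - k h`. -/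
theorem IsVonNeumannRegularRing.exists_unit (hS : IsVonNeumannRegularRing S) {g : S}
    (hg : g * g = g) (b : S) :
    ∃ e, e * e = e ∧ e * g = g ∧ g * e = g ∧ e * b = b ∧ b * e = b := by
  obtain ⟨h, hh, hhg, hhb⟩ := hS.exists_left_unit hg b
  obtain ⟨k₁, hk₁, hhk₁, hgk₁⟩ := hS.exists_right_unit hh g
  obtain ⟨k, hk, hk₁k, hbk⟩ := hS.exists_right_unit hk₁ b
  have hhk : h * k = h := by rw [← hhk₁, mul_assoc, hk₁k]
  have hgk : g * k = g := by rw [← hgk₁, mul_assoc, hk₁k]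
  have hl : ∀ {a}, h * a = a → (h + k - k * h) * a = a := fun {a} ha => by
    rw [sub_mul, add_mul, mul_assoc, ha, add_sub_cancel_right]
  have hr : ∀ {a}, a * k = a → a * (h + k - k * h) = a := fun {a} ha => by
    rw [mul_sub, mul_add, ← mul_assoc, ha, add_sub_cancel_left]
  refine ⟨h + k - k * h, ?_, hl hhg, hr hgk, hl hhb, hr hbk⟩
  have h1 : (h + k - k * h) * k = h + k - k * h := by
    rw [sub_mul, add_mul, hhk, hk, mul_assoc, hhk]
  rw [mul_sub, mul_add, hl hh, h1, ← mul_assoc, h1, hl hh]; abel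

/-- An approximate unit consisting of an increasing sequence of idempotents. -/
structure IsIdempotentUnit (e : ℕ → S) : Prop where
  zero : e 0 = 0
  mul_of_le : ∀ {m n}, m ≤ n → e m * e n = e m
  mul_of_le' : ∀ {m n}, m ≤ n → e n * e m = e m
  exists_unit : ∀ x, ∃ n, e n * x = x ∧ x * e n = x

theorem exists_isIdempotentUnit (hS : IsVonNeumannRegularRing S)
    (hσ : IsSigmaUnital S) : ∃ e : ℕ → S, IsIdempotentUnit e := by
  obtain ⟨u, hu⟩ := hσ
  have hstep : ∀ n (g : {g : S // g * g = g}), ∃ e : {g : S // g * g = g},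
      e.1 * g.1 = g.1 ∧ g.1 * e.1 = g.1 ∧ e.1 * u n = u n ∧ u n * e.1 = u n := fun n g => by
    obtain ⟨e, he, h⟩ := hS.exists_unit g.2 (u n)
    exact ⟨⟨e, he⟩, h⟩
  choose next hn using hstep
  let e : ℕ → {g : S // g * g = g} := fun n => Nat.rec ⟨0, mul_zero 0⟩ next n
  have hl : ∀ {m n}, m ≤ n → (e m).1 * (e n).1 = (e m).1 := fun {m n} hmn => by
    induction n, hmn using Nat.le_induction with
    | base => exact (e m).2
    | succ n _ ih =>
      have : (e n).1 * (e (n + 1)).1 = (e n).1 := (hn n (e n)).2.1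
      rw [← ih, mul_assoc, this]
  have hl' : ∀ {m n}, m ≤ n → (e n).1 * (e m).1 = (e m).1 := fun {m n} hmn => by
    induction n, hmn using Nat.le_induction with
    | base => exact (e m).2
    | succ n _ ih =>
      have : (e (n + 1)).1 * (e n).1 = (e n).1 := (hn n (e n)).1
      rw [← ih, ← mul_assoc, this]
  refine ⟨fun n => (e n).1, rfl, hl, hl', fun x => ?_⟩
  obtain ⟨n, h1, h2⟩ := (hu x).exists
  have h3 : (e (n + 1)).1 * u n = u n := (hn n (e n)).2.2.1
  have h4 : u n * (e (n + 1)).1 = u n := (hn n (e n)).2.2.2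
  refine ⟨n + 1, ?_, ?_⟩
  · rw [← h1, ← mul_assoc, h3]
  · rw [← h2, mul_assoc, h4]

theorem IsIdempotentUnit.map {T : Type*} [NonUnitalRing T] {e : ℕ → S}
    (he : IsIdempotentUnit e) (f : S →ₙ+* T) (hf : Function.Surjective f) :
    IsIdempotentUnit fun n => f (e n) where
  zero := by rw [he.zero, map_zero]
  mul_of_le hmn := by rw [← map_mul, he.mul_of_le hmn]
  mul_of_le' hmn := by rw [← map_mul, he.mul_of_le' hmn]
  exists_unit y := by
    obtain ⟨x, rfl⟩ := hf y
    obtain ⟨n, h1, h2⟩ := he.exists_unit x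
    exact ⟨n, by rw [← map_mul, h1], by rw [← map_mul, h2]⟩

end LocalUnits

/-! ### Multiplier rings -/

/-- A ring is non-degenerate if neither its left nor its right annihilator contains a non-zero
element. -/
structure IsNondegenerate (S : Type u) [NonUnitalRing S] : Prop where
  left : ∀ x : S, (∀ y, y * x = 0) → x = 0
  right : ∀ x : S, (∀ y, x * y = 0) → x = 0

theorem IsVonNeumannRegularRing.isNondegenerate {S : Type u} [NonUnitalRing S]
    (hS : IsVonNeumannRegularRing S) : IsNondegenerate S where
  left x hx := by
    obtain ⟨y, hy⟩ := hS x
    rw [hy, hx]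
  right x hx := by
    obtain ⟨y, hy⟩ := hS x
    rw [hy, mul_assoc, hx]

namespace IsNondegenerate

variable {S : Type u} [NonUnitalRing S]

theorem left_ext (hS : IsNondegenerate S) {a b : S} (h : ∀ y, y * a = y * b) : a = b :=
  sub_eq_zero.1 (hS.left _ fun y => by rw [mul_sub, h, sub_self])

theorem right_ext (hS : IsNondegenerate S) {a b : S} (h : ∀ y, a * y = b * y) : a = b :=
  sub_eq_zero.1 (hS.right _ fun y => by rw [sub_mul, h, sub_self])

end IsNondegenerate

namespace multiplierRing

variable {S : Type u} [NonUnitalRing S]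

/-- The left component `λ` of a double centralizer `(λ, ρ)`. -/
def l (m : multiplierRing S) : S →+ S := m.1.1

/-- The right component `ρ` of a double centralizer `(λ, ρ)`. -/
def r (m : multiplierRing S) : S →+ S := m.1.2.unop

theorem ext_components {m m' : multiplierRing S} (h : ∀ x, l m x = l m' x)
    (h' : ∀ x, r m x = r m' x) : m = m' :=
  Subtype.ext (Prod.ext (AddMonoidHom.ext h) (MulOpposite.unop_injective (AddMonoidHom.ext h')))

theorem l_mul_right (m : multiplierRing S) (x y : S) : l m (x * y) = l m x * y := m.2.1 x y

theorem r_mul_left (m : multiplierRing S) (x y : S) : r m (x * y) = x * r m y := m.2.2.1 x y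

theorem mul_l (m : multiplierRing S) (x y : S) : x * l m y = r m x * y := m.2.2.2 x y

theorem l_mul (m m' : multiplierRing S) (x : S) : l (m * m') x = l m (l m' x) := rfl

theorem l_add (m m' : multiplierRing S) (x : S) : l (m + m') x = l m x + l m' x := rfl

theorem r_add (m m' : multiplierRing S) (x : S) : r (m + m') x = r m x + r m' x := rfl

theorem l_one (x : S) : l (1 : multiplierRing S) x = x := rfl

theorem l_zero (x : S) : l (0 : multiplierRing S) x = 0 := rfl

theorem ext_left (hS : IsNondegenerate S) {m m' : multiplierRing S} (h : ∀ x, l m x = l m' x) :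
    m = m' :=
  ext_components h fun x => hS.right_ext fun y => by rw [← mul_l, ← mul_l, h]

theorem exists_of_coherent (hS : IsNondegenerate S) (f g : S → S) (h : ∀ x y, x * f y = g x * y) :
    ∃ m : multiplierRing S, (∀ x, l m x = f x) ∧ ∀ x, r m x = g x := by
  obtain ⟨m, hm, h1, h2⟩ := exists_mem_multiplierRing_of_coherent hS.left hS.right f g h
  exact ⟨⟨m, hm⟩, h1, h2⟩

/-- The canonical homomorphism of a ring to its multiplier ring, sending `s` to the pair of left and
right multiplication by `s`. -/
def of : S →ₙ+* multiplierRing S where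
  toFun s := ⟨(AddMonoidHom.mulLeft s, MulOpposite.op (AddMonoidHom.mulRight s)),
    fun x y => (mul_assoc s x y).symm, fun x y => mul_assoc x y s,
    fun x y => (mul_assoc x s y).symm⟩
  map_mul' s t := ext_components (fun x => mul_assoc s t x) fun x => (mul_assoc x s t).symm
  map_zero' := ext_components (fun x => zero_mul x) fun x => mul_zero x
  map_add' s t := ext_components (fun x => add_mul s t x) fun x => mul_add x s t

theorem l_of (s x : S) : l (of s) x = s * x := rfl

theorem mul_of (m : multiplierRing S) (s : S) : m * of s = of (l m s) :=
  ext_components (fun x => l_mul_right m s x) fun x => (mul_l m x s).symm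

theorem of_mul (m : multiplierRing S) (s : S) : of s * m = of (r m s) :=
  ext_components (fun x => mul_l m s x) fun x => r_mul_left m x s

theorem of_injective (hS : IsNondegenerate S) : Function.Injective (of : S → multiplierRing S) :=
  fun _ _ h => hS.right_ext fun y => congrArg (fun m => l m y) h

/-- The sum of a strictly null sequence of multipliers exists: on each element of the ring only
finitely many terms contribute. -/
theorem exists_strict_sum (hS : IsNondegenerate S) (c : ℕ → multiplierRing S)
    (hc : ∀ x : S, ∀ᶠ n in Filter.atTop, l (c n) x = 0 ∧ r (c n) x = 0) :
    ∃ m : multiplierRing S, ∀ x, ∀ᶠ N in Filter.atTop,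
      l m x = l (∑ i ∈ Finset.range N, c i) x ∧ r m x = r (∑ i ∈ Finset.range N, c i) x := by
  have hlsum : ∀ N x, l (∑ i ∈ Finset.range N, c i) x = ∑ i ∈ Finset.range N, l (c i) x := by
    intro N x
    induction N with
    | zero => rfl
    | succ N ih => rw [Finset.sum_range_succ, Finset.sum_range_succ, l_add, ih]
  have hrsum : ∀ N x, r (∑ i ∈ Finset.range N, c i) x = ∑ i ∈ Finset.range N, r (c i) x := by
    intro N x
    induction N with
    | zero => rfl
    | succ N ih => rw [Finset.sum_range_succ, Finset.sum_range_succ, r_add, ih]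
  choose K hK using fun x => Filter.eventually_atTop.1 (hc x)
  have hl : ∀ {x N}, K x ≤ N →
      l (∑ i ∈ Finset.range (K x), c i) x = l (∑ i ∈ Finset.range N, c i) x := fun {x N} hN => by
    rw [hlsum, hlsum, ← Finset.sum_range_add_sum_Ico _ hN, Finset.sum_eq_zero (s := Finset.Ico _ _),
      add_zero]
    exact fun i hi => (hK x i (Finset.mem_Ico.1 hi).1).1
  have hr : ∀ {x N}, K x ≤ N →
      r (∑ i ∈ Finset.range (K x), c i) x = r (∑ i ∈ Finset.range N, c i) x := fun {x N} hN => by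
    rw [hrsum, hrsum, ← Finset.sum_range_add_sum_Ico _ hN, Finset.sum_eq_zero (s := Finset.Ico _ _),
      add_zero]
    exact fun i hi => (hK x i (Finset.mem_Ico.1 hi).1).2
  obtain ⟨m, hml, hmr⟩ := exists_of_coherent hS
    (fun x => l (∑ i ∈ Finset.range (K x), c i) x) (fun x => r (∑ i ∈ Finset.range (K x), c i) x)
    fun x y => by
      rw [hl (le_max_right (K x) (K y)), hr (le_max_left (K x) (K y)), mul_l]
  refine ⟨m, fun x => ?_⟩
  filter_upwards [Filter.eventually_ge_atTop (K x)] with N hN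
  exact ⟨(hml x).trans (hl hN), (hmr x).trans (hr hN)⟩

/-- An increasing idempotent approximate unit of a regular ring is a strict exhaustion of its
multiplier ring. -/
theorem isStrictExhaustion (hS : IsVonNeumannRegularRing S) {e : ℕ → S} (he : IsIdempotentUnit e) :
    IsStrictExhaustion fun n => (of (e n) : multiplierRing S) where
  zero := by rw [he.zero, map_zero]
  mul_of_le hmn := by rw [← map_mul, he.mul_of_le hmn]
  mul_of_le' hmn := by rw [← map_mul, he.mul_of_le' hmn]
  eq_zero a ha := ext_left hS.isNondegenerate fun x => by
    obtain ⟨n, hn, -⟩ := he.exists_unit x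
    have : l a (e n) = 0 := of_injective hS.isNondegenerate (by rw [← mul_of, ha, map_zero])
    rw [← hn, l_mul_right, this, zero_mul, l_zero]
  exists_left a n := by
    obtain ⟨k, hk, -⟩ := he.exists_unit (l a (e n))
    exact ⟨k, by rw [mul_of, ← map_mul, hk]⟩
  exists_right a n := by
    obtain ⟨k, -, hk⟩ := he.exists_unit (r a (e n))
    exact ⟨k, by rw [of_mul, ← map_mul, hk]⟩
  regular n a ha _ := by
    rw [of_mul] at ha
    obtain ⟨y, hy⟩ := hS (r a (e n))
    exact ⟨of y, by rw [← ha, ← map_mul, ← map_mul, ← hy]⟩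
  exists_sum c hc := by
    obtain ⟨m, hm⟩ := exists_strict_sum hS.isNondegenerate c fun x => by
      obtain ⟨k, hk, hk'⟩ := he.exists_unit x
      filter_upwards [hc k] with n ⟨h1, h2⟩
      rw [mul_of] at h2
      rw [of_mul] at h1
      have h1' : r (c n) (e k) = 0 := of_injective hS.isNondegenerate (by rw [h1, map_zero])
      have h2' : l (c n) (e k) = 0 := of_injective hS.isNondegenerate (by rw [h2, map_zero])
      constructor
      · rw [← hk, l_mul_right, h2', zero_mul]
      · rw [← hk', r_mul_left, h1', mul_zero]
    refine ⟨m, fun k => ?_⟩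
    filter_upwards [hm (e k)] with N ⟨h1, h2⟩
    rw [mul_of, mul_of, of_mul, of_mul, h1, h2]
    exact ⟨rfl, rfl⟩

section Map

variable {T : Type u} [NonUnitalRing T]

theorem map_l_eq_of_map_eq (hT : IsNondegenerate T) {f : S →ₙ+* T} (hf : Function.Surjective f)
    (m : multiplierRing S) {x y : S} (h : f x = f y) : f (l m x) = f (l m y) :=
  hT.left_ext fun z => by
    obtain ⟨z, rfl⟩ := hf z
    rw [← map_mul, ← map_mul, mul_l, mul_l, map_mul, map_mul, h]

theorem map_r_eq_of_map_eq (hT : IsNondegenerate T) {f : S →ₙ+* T} (hf : Function.Surjective f)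
    (m : multiplierRing S) {x y : S} (h : f x = f y) : f (r m x) = f (r m y) :=
  hT.right_ext fun z => by
    obtain ⟨z, rfl⟩ := hf z
    rw [← map_mul, ← map_mul, ← mul_l, ← mul_l, map_mul, map_mul, h]

theorem exists_map (hT : IsNondegenerate T) (f : S →ₙ+* T) (hf : Function.Surjective f)
    (m : multiplierRing S) :
    ∃ m' : multiplierRing T, ∀ x, l m' (f x) = f (l m x) ∧ r m' (f x) = f (r m x) := by
  obtain ⟨g, hg⟩ := hf.hasRightInverse
  obtain ⟨m', hl, hr⟩ := exists_of_coherent hT (fun x => f (l m (g x))) (fun x => f (r m (g x)))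
    fun x y => by
      calc x * f (l m (g y)) = f (g x * l m (g y)) := by rw [map_mul, hg]
        _ = f (r m (g x)) * y := by rw [mul_l, map_mul, hg]
  exact ⟨m', fun x => ⟨(hl _).trans (map_l_eq_of_map_eq hT hf m (hg _)),
    (hr _).trans (map_r_eq_of_map_eq hT hf m (hg _))⟩⟩

/-- The homomorphism of multiplier rings induced by a surjective ring homomorphism `f` onto a
non-degenerate ring: the image of `m` is the multiplier that acts on `f x` as `f ∘ m` acts on
`x`. -/
noncomputable def map (hT : IsNondegenerate T) (f : S →ₙ+* T) (hf : Function.Surjective f) :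
    multiplierRing S →+* multiplierRing T where
  toFun m := (exists_map hT f hf m).choose
  map_one' := ext_left hT <| hf.forall.2 fun x => by
    rw [((exists_map hT f hf 1).choose_spec x).1, l_one, l_one]
  map_zero' := ext_left hT <| hf.forall.2 fun x => by
    rw [((exists_map hT f hf 0).choose_spec x).1, l_zero, l_zero, map_zero]
  map_add' m m' := ext_left hT <| hf.forall.2 fun x => by
    rw [((exists_map hT f hf _).choose_spec x).1, l_add, l_add, map_add,
      ((exists_map hT f hf m).choose_spec x).1, ((exists_map hT f hf m').choose_spec x).1]
  map_mul' m m' := ext_left hT <| hf.forall.2 fun x => by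
    rw [((exists_map hT f hf _).choose_spec x).1, l_mul, l_mul,
      ((exists_map hT f hf m').choose_spec x).1, ((exists_map hT f hf m).choose_spec _).1]

variable (hT : IsNondegenerate T) (f : S →ₙ+* T) (hf : Function.Surjective f)

theorem l_map (m : multiplierRing S) (x : S) : l (map hT f hf m) (f x) = f (l m x) :=
  ((exists_map hT f hf m).choose_spec x).1

theorem r_map (m : multiplierRing S) (x : S) : r (map hT f hf m) (f x) = f (r m x) :=
  ((exists_map hT f hf m).choose_spec x).2

theorem map_of (s : S) : map hT f hf (of s) = of (f s) :=
  ext_left hT <| hf.forall.2 fun x => by rw [l_map, l_of, l_of, map_mul]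

/-- Multipliers lift along surjections of `σ`-unital regular rings; this is an algebraic analogue
of the Tietze extension theorem. -/
theorem map_surjective (hS : IsVonNeumannRegularRing S) (hσ : IsSigmaUnital S)
    (hTreg : IsVonNeumannRegularRing T) : Function.Surjective (map hT f hf) := by
  obtain ⟨e, he⟩ := exists_isIdempotentUnit hS hσ
  have hB : IsStrictExhaustion fun n => map hT f hf (of (e n)) := by
    simp only [map_of]
    exact isStrictExhaustion hTreg (he.map f hf)
  refine IsStrictExhaustion.surjective_of_corners _ (isStrictExhaustion hS he) hB
    fun n b hb _ => ?_
  rw [map_of, of_mul] at hb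
  obtain ⟨s, hs⟩ := hf (r b (f (e n)))
  exact ⟨of s, by rw [map_of, hs, hb]⟩

end Map

end multiplierRing

/-! ### Inverse limits of rings -/

namespace inverseLimit

variable {R : ℕ → Type u} [∀ n, NonUnitalRing (R n)] {π : ∀ n, R (n + 1) →ₙ+* R n}

/-- The projection of the inverse limit to a component. -/
def proj (n : ℕ) : inverseLimit R π →ₙ+* R n where
  toFun x := x.1 n
  map_mul' _ _ := rfl
  map_zero' := rfl
  map_add' _ _ := rfl

theorem map_proj (n : ℕ) (x : inverseLimit R π) : π n (proj (n + 1) x) = proj n x := x.2 n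

theorem ext_proj {x y : inverseLimit R π} (h : ∀ n, proj n x = proj n y) : x = y :=
  Subtype.ext (funext h)

theorem proj_surjective {R : ℕ → Type u} [∀ n, NonUnitalRing (R n)]
    {π : ∀ n, R (n + 1) →ₙ+* R n} (hπ : ∀ n, Function.Surjective (π n)) (n : ℕ) :
    Function.Surjective (proj n : inverseLimit R π → R n) := by
  -- The induction passes to the system shifted by one index.
  induction n generalizing R with
  | zero =>
    intro a
    choose g hg using hπ
    exact ⟨⟨fun k => Nat.rec a (fun k b => g k b) k, fun k => hg k _⟩, rfl⟩
  | succ n ih =>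
    intro a
    obtain ⟨x, hx⟩ := ih (R := fun k => R (k + 1)) (π := fun k => π (k + 1)) (fun k => hπ (k + 1)) a
    let y : ∀ k, R k := fun k => Nat.rec (π 0 (x.1 0)) (fun k _ => x.1 k) k
    have hy : ∀ k, π k (y (k + 1)) = y k := fun k => by
      cases k with
      | zero => rfl
      | succ k => exact x.2 k
    exact ⟨⟨y, hy⟩, hx⟩

theorem isNondegenerate (hπ : ∀ n, Function.Surjective (π n))
    (hR : ∀ n, IsNondegenerate (R n)) : IsNondegenerate (inverseLimit R π) where
  left x hx := ext_proj fun n => (hR n).left _ <| (proj_surjective hπ n).forall.2 fun y => by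
    rw [← map_mul, hx, map_zero]
  right x hx := ext_proj fun n => (hR n).right _ <| (proj_surjective hπ n).forall.2 fun y => by
    rw [← map_mul, hx, map_zero]

end inverseLimit

theorem mainTheorem9 (R : ℕ → Type u) [∀ n, NonUnitalRing (R n)]
    (π : ∀ n, R (n + 1) →ₙ+* R n) (hπ : ∀ n, Function.Surjective (π n))
    (hσ : ∀ n, IsSigmaUnital (R n)) (hreg : ∀ n, IsVonNeumannRegularRing (R n)) :
    IsExchangeRing (multiplierRing (inverseLimit R π)) := by
  have hR : ∀ n, IsNondegenerate (R n) := fun n => (hreg n).isNondegenerate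
  have hproj := inverseLimit.proj_surjective hπ
  have hL : IsNondegenerate (inverseLimit R π) := inverseLimit.isNondegenerate hπ hR
  refine IsExchangeRing.of_limit
    (fun n => multiplierRing.map (hR n) (inverseLimit.proj n) (hproj n))
    (fun n => multiplierRing.map (hR n) (π n) (hπ n))
    (fun n => multiplierRing.map_surjective _ _ _ (hreg (n + 1)) (hσ (n + 1)) (hreg n))
    (fun n m => multiplierRing.ext_left (hR n) <| (hproj n).forall.2 fun x => ?_)
    (fun m m' h => multiplierRing.ext_left hL fun x => inverseLimit.ext_proj fun n => ?_)
    (fun b hb => ?_) (fun n => ?_)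
  · rw [multiplierRing.l_map, ← inverseLimit.map_proj, multiplierRing.l_map, multiplierRing.l_map,
      inverseLimit.map_proj]
  · rw [← multiplierRing.l_map (hR n) _ (hproj n), h, multiplierRing.l_map]
  · -- compatible multipliers act componentwise on the inverse limit
    obtain ⟨m, hm, -⟩ := multiplierRing.exists_of_coherent hL
      (fun x => ⟨fun n => multiplierRing.l (b n) (x.1 n), fun n => by
        dsimp only
        rw [← hb n, ← x.2 n, multiplierRing.l_map]⟩)
      (fun x => ⟨fun n => multiplierRing.r (b n) (x.1 n), fun n => by
        dsimp only
        rw [← hb n, ← x.2 n, multiplierRing.r_map]⟩)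
      fun x y => Subtype.ext (funext fun n => multiplierRing.mul_l (b n) (x.1 n) (y.1 n))
    refine ⟨m, fun n => multiplierRing.ext_left (hR n) <| (hproj n).forall.2 fun x => ?_⟩
    rw [multiplierRing.l_map, hm]
    rfl
  · obtain ⟨e, he⟩ := exists_isIdempotentUnit (hreg n) (hσ n)
    exact (multiplierRing.isStrictExhaustion (hreg n) he).isExchangeRing
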